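/- A variety of lattices is an equational class of lattices (in the language $\{\wedge,\vee\}$); it is non-distributive if at least one of its members is not a distributive lattice. A lattice $K$ has permutable congruences if $\alpha\beta=\beta\alpha$ for all congruences $\alpha,\beta$ of $K$, where $\alpha\beta=\{(x,y) : \exists z,\ (x,z)\in\alpha \text{ and } (z,y)\in\beta\}$. For a lattice $L$, $\operatorname{Con}_c L$ denotes the $\{\vee,0\}$-semilattice of compact (that is, finitely generated) congruences of $L$. Let $\mathcal V$ be any non-distributive variety of lattices, and let $F$ be any free lattice in $\mathcal V$ on a set of at least $\aleph_2$ generators. Then there is no lattice $K$ with permutable congruences such that $\operatorname{Con}_c K\cong\operatorname{Con}_c F$. -/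

import Mathlib

universe u v w z

/-! ## Congruences of lattices -/

namespace LatticeCon

variable {L : Type u} [Lattice L]

theorem ext_rel {c d : LatticeCon L} (h : ∀ x y, c.r x y ↔ d.r x y) : c = d := by
  rcases c with ⟨c, _, _⟩
  rcases d with ⟨d, _, _⟩
  have hcd : c = d := Setoid.ext h
  subst hcd
  rfl

/-- Congruences are ordered by inclusion (as binary relations). -/
instance instPartialOrder : PartialOrder (LatticeCon L) where
  le c d := ∀ ⦃x y : L⦄, c.r x y → d.r x y
  le_refl _ _ _ h := h
  le_trans _ _ _ hcd hde _ _ h := hde (hcd h)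
  le_antisymm _ _ hcd hdc := ext_rel fun _ _ => ⟨fun h => hcd h, fun h => hdc h⟩

theorem le_def {c d : LatticeCon L} : c ≤ d ↔ ∀ ⦃x y : L⦄, c.r x y → d.r x y := Iff.rfl

/-- The intersection of a set of congruences. -/
instance instInfSet : InfSet (LatticeCon L) where
  sInf S :=
    { r := fun x y => ∀ c ∈ S, c.r x y
      iseqv :=
        ⟨fun x c _ => c.iseqv.refl x, fun h c hc => c.iseqv.symm (h c hc),
          fun h h' c hc => c.iseqv.trans (h c hc) (h' c hc)⟩
      inf := fun h h' c hc => c.inf (h c hc) (h' c hc)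
      sup := fun h h' c hc => c.sup (h c hc) (h' c hc) }

/-- The congruence lattice `Con L`, a complete lattice under inclusion. -/
instance instCompleteLattice : CompleteLattice (LatticeCon L) :=
  completeLatticeOfInf (LatticeCon L) fun _ =>
    ⟨fun c hc _ _ h => h c hc, fun _ hd _ _ h _ hc => hd hc h⟩

end LatticeCon

/-- `Con_c L`: the compact congruences of `L`, ordered by inclusion. -/
abbrev CompactCon (L : Type u) [Lattice L] : Type u :=
  {c : LatticeCon L // IsCompactElement c}

namespace CompactCon

variable {L : Type u} [Lattice L]

theorem isCompactElement_sup {c d : LatticeCon L} (hc : IsCompactElement c)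
    (hd : IsCompactElement d) : IsCompactElement (c ⊔ d) := by
  intro S e hS hdir he hle
  obtain ⟨x, hx, hcx⟩ := hc S e hS hdir he (le_sup_left.trans hle)
  obtain ⟨y, hy, hdy⟩ := hd S e hS hdir he (le_sup_right.trans hle)
  obtain ⟨z, hz, hxz, hyz⟩ := hdir x hx y hy
  exact ⟨z, hz, sup_le (hcx.trans hxz) (hdy.trans hyz)⟩

theorem isCompactElement_bot : IsCompactElement (⊥ : LatticeCon L) := by
  intro S e hS _ _ _
  obtain ⟨x, hx⟩ := hS
  exact ⟨x, hx, bot_le⟩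

/-- `Con_c L` is a join-semilattice; joins are computed in `Con L`. -/
instance instSemilatticeSup : SemilatticeSup (CompactCon L) :=
  Subtype.semilatticeSup fun _ _ hc hd => isCompactElement_sup hc hd

/-- The zero of `Con_c L` is the identity congruence. -/
instance instOrderBot : OrderBot (CompactCon L) :=
  Subtype.orderBot isCompactElement_bot

end CompactCon

/-- `L` has permutable congruences: `αβ = βα` (composition of binary relations) for all
congruences `α`, `β` of `L`. -/
def HasPermutableCongruences (L : Type u) [Lattice L] : Prop :=
  ∀ a b : LatticeCon L, Relation.Comp a.r b.r = Relation.Comp b.r a.r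

/-! ## Varieties of lattices -/

/-- Lattice terms in the variables `X`. -/
inductive LatticeTerm (X : Type u) : Type u where
  | var : X → LatticeTerm X
  | inf : LatticeTerm X → LatticeTerm X → LatticeTerm X
  | sup : LatticeTerm X → LatticeTerm X → LatticeTerm X

/-- The value of a lattice term in a lattice under an assignment of the variables. -/
def LatticeTerm.eval {X : Type u} {L : Type v} [Lattice L] (f : X → L) : LatticeTerm X → L
  | .var x => f x
  | .inf s t => s.eval f ⊓ t.eval f
  | .sup s t => s.eval f ⊔ t.eval f

/-- A variety (equational class) of lattices, presented by a set of identities `s ≈ t` between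
lattice terms in countably many variables. -/
structure LatticeVariety : Type where
  identities : Set (LatticeTerm ℕ × LatticeTerm ℕ)

namespace LatticeVariety

/-- The lattice `L` belongs to the variety `V`: it satisfies all identities of `V`. -/
def Mem (V : LatticeVariety) (L : Type u) [Lattice L] : Prop :=
  ∀ e ∈ V.identities, ∀ f : ℕ → L, e.1.eval f = e.2.eval f

/-- The variety `V` is distributive: all its members (in `Type u`) are distributive lattices. -/
def IsDistributive (V : LatticeVariety) : Prop :=
  ∀ (L : Type u) [Lattice L], V.Mem L → ∀ x y z : L, x ⊓ (y ⊔ z) = (x ⊓ y) ⊔ (x ⊓ z)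

/-- `F`, with `ι : X → F`, is a free lattice in `V` on the set `X` of generators.
The universe of the test lattices contains copies of `F` and of the term lattices over `X`,
so that the universal property determines `F` up to isomorphism. -/
structure IsFree (V : LatticeVariety) {X : Type u} {F : Type v} [Lattice F] (ι : X → F) :
    Prop where
  mem : V.Mem F
  existsUnique_lift : ∀ (L : Type (max u v)) [Lattice L], V.Mem L → ∀ f : X → L,
    ∃! g : LatticeHom F L, ∀ x, g (ι x) = f x

end LatticeVariety

/-! ## Nondistributive lattices -/

/-! The obstruction is a refinement property of `Con_c`. If congruences permute, each relation `e ≤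
a i ⊔ b i` is witnessed by interpolating elements, and the congruences `c i j` identifying the
`i`-th and `j`-th interpolants satisfy `WeakUniformRefinement`
(`HasPermutableCongruences.weakUniformRefinement`). The free lattice violates it. Index its
generators as two bounds and `|X|` many pairs; let `e` identify the bounds, `a i` collapse the
`i`-th pair outwards onto them, and `b i` collapse the pair itself. Each `c i j` involves finitely
many generators, so on `ℵ₂` indices `exists_free_triple` yields `i, j, k` such that the generators
of each of `c i j`, `c j k`, `c i k` avoid the third pair. A nondistributive variety contains `y`
with relative complements `x` and `z`, `¬ z ≤ x`; they define a homomorphism `g` whose kernel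
contains `c i j` and `c j k` but not `c i k`, against `c i k ≤ c i j ⊔ c j k`. -/

section Distributivity

variable {L : Type u} [Lattice L]

/-- With `d`, `e` the lower and upper medians of `a, b, c`, the elements `p ⊓ e ⊔ d` are the middle
elements of a diamond. Only the bounds actually needed on `d` are assumed, so that the statement can
be dualized. -/
theorem inf_median_le [IsModularLattice L] {a b c d e : L}
    (hd : d ≤ b ⊔ c ⊓ a) (hab : a ⊓ b ≤ d) (hca : c ⊓ a ≤ d) :
    (a ⊓ e ⊔ d) ⊓ (b ⊓ e ⊔ d) ≤ d := by
  have h₁ : a ⊓ (b ⊔ c ⊓ a) ≤ d := by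
    rw [inf_comm, sup_comm, sup_inf_assoc_of_le b (inf_le_right : c ⊓ a ≤ a)]
    exact sup_le hca (inf_comm a b ▸ hab)
  rw [sup_comm (a ⊓ e), sup_inf_assoc_of_le (a ⊓ e) (le_sup_right : d ≤ b ⊓ e ⊔ d)]
  exact sup_le le_rfl
    ((inf_le_inf inf_le_left (sup_le (inf_le_left.trans le_sup_left) hd)).trans h₁)

theorem le_sup_median [IsModularLattice L] {a b c d e : L} (hde : d ≤ e)
    (he : b ⊓ (c ⊔ a) ≤ e) (hab : e ≤ a ⊔ b) (hca : e ≤ c ⊔ a) :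
    e ≤ (a ⊓ e ⊔ d) ⊔ (b ⊓ e ⊔ d) := by
  have h := inf_median_le (L := Lᵒᵈ) (a := OrderDual.toDual a) (b := OrderDual.toDual b)
    (c := OrderDual.toDual c) (d := OrderDual.toDual e) (e := OrderDual.toDual d) he hab hca
  have h' : e ≤ ((a ⊔ d) ⊓ e) ⊔ ((b ⊔ d) ⊓ e) := h
  rwa [sup_comm a, sup_comm b, sup_inf_assoc_of_le a hde, sup_inf_assoc_of_le b hde,
    sup_comm d, sup_comm d] at h'

/-- A lattice with unique relative complements is distributive. -/
theorem inf_sup_eq_of_unique_relative_complements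
    (h : ∀ x y z : L, x ⊓ y = z ⊓ y → x ⊔ y = z ⊔ y → z ≤ x) (a b c : L) :
    a ⊓ (b ⊔ c) = (a ⊓ b) ⊔ (a ⊓ c) := by
  -- The pentagon: `(x ⊔ y) ⊓ z` and `x ⊔ y ⊓ z` have the same meet and the same join with `y`.
  have : IsModularLattice L := ⟨fun {x} y z hxz => by
    refine h _ y _ ?_ ?_
    · apply le_antisymm
      · exact le_inf (le_inf (inf_le_left.trans (sup_le le_sup_left (inf_le_left.trans le_sup_right)))
          (inf_le_left.trans (sup_le hxz inf_le_right))) inf_le_right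
      · exact le_inf (le_sup_of_le_right (le_inf inf_le_right (inf_le_left.trans inf_le_right)))
          inf_le_right
    · apply le_antisymm
      · exact sup_le (sup_le (le_sup_of_le_left (le_inf le_sup_left hxz))
          (inf_le_left.trans le_sup_right)) le_sup_right
      · exact sup_le (inf_le_left.trans (sup_le (le_sup_left.trans le_sup_left) le_sup_right))
          le_sup_right⟩
  set d := a ⊓ b ⊔ b ⊓ c ⊔ c ⊓ a with hd
  set e := (a ⊔ b) ⊓ (b ⊔ c) ⊓ (c ⊔ a) with he
  have d₁ : a ⊓ b ≤ d := le_sup_left.trans le_sup_left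
  have d₂ : b ⊓ c ≤ d := le_sup_right.trans le_sup_left
  have d₃ : c ⊓ a ≤ d := le_sup_right
  have e₁ : e ≤ a ⊔ b := inf_le_left.trans inf_le_left
  have e₂ : e ≤ b ⊔ c := inf_le_left.trans inf_le_right
  have e₃ : e ≤ c ⊔ a := inf_le_right
  have hde : d ≤ e := by
    refine sup_le (sup_le ?_ ?_) ?_ <;> refine le_inf (le_inf ?_ ?_) ?_ <;>
      first
        | exact inf_le_left.trans le_sup_left
        | exact inf_le_left.trans le_sup_right
        | exact inf_le_right.trans le_sup_left
  have lower : ∀ p q : L, (p ⊓ e ⊔ d) ⊓ (q ⊓ e ⊔ d) ≤ d →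
      (p ⊓ e ⊔ d) ⊓ (q ⊓ e ⊔ d) = d := fun p q hpq =>
    le_antisymm hpq (le_inf le_sup_right le_sup_right)
  have upper : ∀ p q : L, e ≤ (p ⊓ e ⊔ d) ⊔ (q ⊓ e ⊔ d) →
      (p ⊓ e ⊔ d) ⊔ (q ⊓ e ⊔ d) = e := fun p q hpq =>
    le_antisymm (sup_le (sup_le inf_le_right hde) (sup_le inf_le_right hde)) hpq
  have ab := lower a b (inf_median_le (c := c)
    (sup_le (sup_le (inf_le_right.trans le_sup_left) (inf_le_left.trans le_sup_left))
      le_sup_right) d₁ d₃)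
  have bc := lower b c (inf_median_le (c := a)
    (sup_le (sup_le le_sup_right (inf_le_right.trans le_sup_left))
      (inf_le_left.trans le_sup_left)) d₂ d₁)
  have ca := lower c a (inf_median_le (c := b)
    (sup_le (sup_le (inf_le_left.trans le_sup_left) le_sup_right)
      (inf_le_right.trans le_sup_left)) d₃ d₂)
  have ab' := upper a b (le_sup_median (c := c) hde
    (le_inf (le_inf (inf_le_left.trans le_sup_right) (inf_le_left.trans le_sup_left))
      inf_le_right) e₁ e₃)
  have bc' := upper b c (le_sup_median (c := a) hde
    (le_inf (le_inf inf_le_right (inf_le_left.trans le_sup_right))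
      (inf_le_left.trans le_sup_left)) e₂ e₁)
  have ca' := upper c a (le_sup_median (c := b) hde
    (le_inf (le_inf (inf_le_left.trans le_sup_left) inf_le_right)
      (inf_le_left.trans le_sup_right)) e₃ e₂)
  -- The diamond: the elements built from `a` and `b` are both complements of the one built from `c`
  -- in `[d, e]`, so they coincide and force `d = e`.
  have hba : b ⊓ e ⊔ d ≤ a ⊓ e ⊔ d :=
    h _ (c ⊓ e ⊔ d) _ (by rw [bc, inf_comm, ca]) (by rw [bc', sup_comm, ca'])
  have hed : e ≤ d := by
    have hab : a ⊓ e ⊔ d ≤ b ⊓ e ⊔ d :=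
      h _ (c ⊓ e ⊔ d) _ (by rw [bc, inf_comm, ca]) (by rw [bc', sup_comm, ca'])
    exact (ab'.ge.trans (sup_le (le_inf le_rfl hab) (le_inf hba le_rfl))).trans ab.le
  apply le_antisymm
  · have h₁ : a ⊓ (b ⊔ c) ≤ (a ⊓ b ⊔ c ⊓ a) ⊔ (b ⊓ c) := by
      refine le_trans ?_ (hed.trans (sup_le (sup_le (le_sup_left.trans le_sup_left) le_sup_right)
        (le_sup_right.trans le_sup_left)))
      exact le_inf (le_inf (inf_le_left.trans le_sup_left) inf_le_right)
        (inf_le_left.trans le_sup_right)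
    refine (le_inf h₁ (inf_le_left : _ ≤ a)).trans ?_
    rw [sup_inf_assoc_of_le (b ⊓ c) (sup_le inf_le_left inf_le_right : a ⊓ b ⊔ c ⊓ a ≤ a)]
    refine sup_le (sup_le le_sup_left (le_sup_of_le_right (le_inf inf_le_right inf_le_left))) ?_
    exact le_sup_of_le_left (le_inf inf_le_right (inf_le_left.trans inf_le_left))
  · exact sup_le (inf_le_inf_left _ le_sup_left) (inf_le_inf_left _ le_sup_right)

end Distributivity

/-! ## A free set theorem -/

theorem exists_mem_notMem_of_mk_lt {I : Type u} {κ : Cardinal.{u}} (hκ : Cardinal.aleph0 ≤ κ)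
    {J : Type u} (hJ : Cardinal.mk J ≤ κ) {T : Set I} (hT : κ < Cardinal.mk T)
    (g : J → Set I) (hg : ∀ i, (g i).Countable) : ∃ t ∈ T, ∀ i, t ∉ g i := by
  by_contra! hc
  refine hT.not_ge ?_
  have hsub : T ⊆ ⋃ i, g i := fun t ht => Set.mem_iUnion.2 (hc t ht)
  refine (Cardinal.mk_le_mk_of_subset hsub).trans ((Cardinal.mk_iUnion_le g).trans ?_)
  exact (mul_le_mul' hJ (ciSup_le' fun i => (Cardinal.le_aleph0_iff_set_countable.2 (hg i)).trans
    hκ)).trans (Cardinal.mul_eq_self hκ).le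

/-- Kuratowski's free set theorem for set mappings of order two on a set of size `ℵ₂`. -/
theorem exists_free_triple {I : Type u} (hI : Cardinal.aleph 2 ≤ Cardinal.mk I)
    (f : I → I → Set I) (hf : ∀ i j, (f i j).Finite) :
    ∃ i j k, i ≠ j ∧ j ≠ k ∧ i ≠ k ∧ k ∉ f i j ∧ j ∉ f i k ∧ i ∉ f j k := by
  have h₀₁ : Cardinal.aleph 0 < Cardinal.aleph 1 := Cardinal.aleph_lt_aleph.2 (by norm_num)
  have h₁₂ : Cardinal.aleph 1 < Cardinal.aleph 2 := Cardinal.aleph_lt_aleph.2 (by norm_num)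
  obtain ⟨A, hA⟩ := Cardinal.le_mk_iff_exists_set.1 (h₁₂.le.trans hI)
  obtain ⟨B, hBA, hB⟩ := Cardinal.le_mk_iff_exists_subset.1 (h₀₁.le.trans hA.ge)
  rw [Cardinal.aleph_zero] at hB h₀₁
  have hBi : B.Infinite := Set.infinite_coe_iff.1 (Cardinal.infinite_iff.2 hB.ge)
  -- Choices run downwards in cardinality: `k` outside `A`, then `j` in `A` outside `B`, then `i` in
  -- `B`. Inserting the first index into the forbidden set makes the three distinct.
  obtain ⟨k, -, hk⟩ := exists_mem_notMem_of_mk_lt (J := A × A) (T := Set.univ) h₀₁.le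
    (by rw [Cardinal.mk_prod, Cardinal.lift_id, hA, Cardinal.mul_eq_self h₀₁.le])
    (by rw [Cardinal.mk_univ]; exact h₁₂.trans_le hI)
    (fun p => insert p.1.1 (f p.1 p.2)) (fun p => ((hf _ _).insert _).countable)
  obtain ⟨j, hjA, hj⟩ := exists_mem_notMem_of_mk_lt (J := B) (T := A) le_rfl hB.le
    (hA.symm ▸ h₀₁) (fun i => insert i.1 (f i k)) (fun i => ((hf _ _).insert _).countable)
  obtain ⟨i, hiB, hi⟩ := hBi.exists_notMem_finite (hf j k)
  have h₁ := hj ⟨i, hiB⟩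
  have h₂ := hk (⟨i, hBA hiB⟩, ⟨j, hjA⟩)
  have h₃ := hk (⟨j, hjA⟩, ⟨j, hjA⟩)
  simp only [Set.mem_insert_iff, not_or] at h₁ h₂ h₃
  exact ⟨i, j, k, Ne.symm h₁.1, Ne.symm h₃.1, Ne.symm h₂.1, h₂.2, h₁.2, hi⟩

/-! ## Compact congruences -/

namespace LatticeCon

variable {L : Type u} [Lattice L]

/-- The congruence generated by a set of pairs. -/
def gen (P : Set (L × L)) : LatticeCon L :=
  sInf {d | ∀ p ∈ P, d.r p.1 p.2}

theorem gen_le_iff {P : Set (L × L)} {d : LatticeCon L} :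
    gen P ≤ d ↔ ∀ p ∈ P, d.r p.1 p.2 :=
  ⟨fun h p hp => h fun _ hc => hc p hp, fun h => sInf_le h⟩

theorem gen_rel {P : Set (L × L)} {x y : L} (h : (x, y) ∈ P) : (gen P).r x y :=
  gen_le_iff.1 le_rfl (x, y) h

/-- The union of a directed set of congruences. -/
def directedUnion (S : Set (LatticeCon L)) (hne : S.Nonempty) (hS : DirectedOn (· ≤ ·) S) :
    LatticeCon L where
  r x y := ∃ c ∈ S, c.r x y
  iseqv :=
    ⟨fun x => hne.imp fun c hc => ⟨hc, c.iseqv.refl x⟩,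
      fun ⟨c, hc, h⟩ => ⟨c, hc, c.iseqv.symm h⟩,
      fun ⟨c, hc, h⟩ ⟨d, hd, h'⟩ =>
        let ⟨e, he, hce, hde⟩ := hS c hc d hd
        ⟨e, he, e.iseqv.trans (hce h) (hde h')⟩⟩
  inf := fun ⟨c, hc, h⟩ ⟨d, hd, h'⟩ =>
    let ⟨e, he, hce, hde⟩ := hS c hc d hd
    ⟨e, he, e.inf (hce h) (hde h')⟩
  sup := fun ⟨c, hc, h⟩ ⟨d, hd, h'⟩ =>
    let ⟨e, he, hce, hde⟩ := hS c hc d hd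
    ⟨e, he, e.sup (hce h) (hde h')⟩

theorem isCompactElement_gen {P : Set (L × L)} (hP : P.Finite) : IsCompactElement (gen P) := by
  intro S e hne hS he hle
  have heS : e ≤ directedUnion S hne hS := he.2 fun c hc x y h => ⟨c, hc, h⟩
  have hPS : ∀ p ∈ P, ∃ c ∈ S, c.r p.1 p.2 := fun p hp => heS (gen_le_iff.1 hle p hp)
  clear hle
  suffices h : ∃ c ∈ S, ∀ p ∈ P, c.r p.1 p.2 from
    h.imp fun c hc => ⟨hc.1, gen_le_iff.2 hc.2⟩
  induction P, hP using Set.Finite.induction_on with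
  | empty => exact hne.imp fun c hc => ⟨hc, by simp⟩
  | @insert q P _ _ ih =>
    obtain ⟨c, hc, hcP⟩ := ih fun p hp => hPS p (Set.mem_insert_of_mem _ hp)
    obtain ⟨d, hd, hdq⟩ := hPS q (Set.mem_insert _ _)
    obtain ⟨f, hf, hcf, hdf⟩ := hS c hc d hd
    refine ⟨f, hf, ?_⟩
    rintro p (rfl | hp)
    · exact hdf hdq
    · exact hcf (hcP p hp)

theorem exists_finite_gen {c : LatticeCon L} (hc : IsCompactElement c) :
    ∃ P : Set (L × L), P.Finite ∧ c = gen P := by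
  obtain ⟨_, ⟨P, ⟨hPf, hPc⟩, rfl⟩, hP⟩ := hc
    (gen '' {P | P.Finite ∧ ∀ p ∈ P, c.r p.1 p.2}) c ⟨gen ∅, ∅, by simp, rfl⟩
    (by
      rintro _ ⟨P, hP, rfl⟩ _ ⟨Q, hQ, rfl⟩
      refine ⟨gen (P ∪ Q), ⟨P ∪ Q, ⟨hP.1.union hQ.1, ?_⟩, rfl⟩, ?_, ?_⟩
      · rintro p (hp | hp)
        exacts [hP.2 p hp, hQ.2 p hp]
      · exact gen_le_iff.2 fun p hp => gen_rel (Or.inl hp)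
      · exact gen_le_iff.2 fun p hp => gen_rel (Or.inr hp))
    ⟨by rintro _ ⟨P, hP, rfl⟩; exact gen_le_iff.2 hP.2, fun d hd x y hxy =>
      hd ⟨{(x, y)}, ⟨Set.finite_singleton _, by simpa using hxy⟩, rfl⟩ (gen_rel rfl)⟩
    le_rfl
  exact ⟨P, hPf, le_antisymm hP (gen_le_iff.2 hPc)⟩

/-- When `a` and `b` permute, their composition is already a congruence, hence contains the join. -/
theorem exists_of_sup_rel (hL : HasPermutableCongruences L) {a b : LatticeCon L} {x y : L}
    (h : (a ⊔ b).r x y) : ∃ t, a.r x t ∧ b.r t y := by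
  have hab : ∀ {x y}, Relation.Comp a.r b.r x y ↔ Relation.Comp b.r a.r x y := by
    intro x y; rw [hL a b]
  let d : LatticeCon L :=
    { r := Relation.Comp a.r b.r
      iseqv :=
        ⟨fun x => ⟨x, a.iseqv.refl x, b.iseqv.refl x⟩,
          fun ⟨t, h, h'⟩ => hab.2 ⟨t, b.iseqv.symm h', a.iseqv.symm h⟩,
          fun {_ y _} ⟨t, h, h'⟩ ⟨s, k, k'⟩ =>
            let ⟨r, l, l'⟩ := hab.2 ⟨y, h', k⟩
            ⟨r, a.iseqv.trans h l, b.iseqv.trans l' k'⟩⟩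
      inf := fun ⟨t, h, h'⟩ ⟨s, k, k'⟩ => ⟨t ⊓ s, a.inf h k, b.inf h' k'⟩
      sup := fun ⟨t, h, h'⟩ ⟨s, k, k'⟩ => ⟨t ⊔ s, a.sup h k, b.sup h' k'⟩ }
  have hd : a ⊔ b ≤ d := sup_le (fun x y h => ⟨y, h, b.iseqv.refl y⟩)
    (fun x y h => ⟨x, a.iseqv.refl x, h⟩)
  exact hd h

end LatticeCon

/-! ## The weak uniform refinement property -/

/-- The weak uniform refinement property of a join-semilattice, for families indexed by `I`. -/
def WeakUniformRefinement (S : Type u) [SemilatticeSup S] (I : Type v) : Prop :=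
  ∀ (e : S) (a b : I → S), (∀ i, e ≤ a i ⊔ b i) →
    ∃ c : I → I → S, (∀ i j, c i j ≤ a i ⊔ a j) ∧ (∀ i j, c i j ≤ b i ⊔ b j) ∧
      (∀ i j, e ≤ c i j ⊔ a i ⊔ b j) ∧ ∀ i j k, c i k ≤ c i j ⊔ c j k

theorem WeakUniformRefinement.of_orderIso {S : Type u} {T : Type v} [SemilatticeSup S]
    [SemilatticeSup T] {I : Type w} (h : WeakUniformRefinement S I) (f : S ≃o T) :
    WeakUniformRefinement T I := by
  intro e a b hab
  obtain ⟨c, h₁, h₂, h₃, h₄⟩ := h (f.symm e) (fun i => f.symm (a i)) (fun i => f.symm (b i))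
    (fun i => by rw [← map_sup]; exact f.symm.monotone (hab i))
  refine ⟨fun i j => f (c i j), fun i j => ?_, fun i j => ?_, fun i j => ?_, fun i j k => ?_⟩
  · simpa using f.monotone (h₁ i j)
  · simpa using f.monotone (h₂ i j)
  · simpa using f.monotone (h₃ i j)
  · simpa using f.monotone (h₄ i j k)

theorem HasPermutableCongruences.weakUniformRefinement {K : Type u} [Lattice K]
    (hK : HasPermutableCongruences K) (I : Type v) :
    WeakUniformRefinement (CompactCon K) I := by
  rintro ⟨e, he⟩ a b hab
  obtain ⟨P, hP, rfl⟩ := LatticeCon.exists_finite_gen he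
  have hx : ∀ i, ∀ p : P, ∃ x, (a i).1.r p.1.1 x ∧ (b i).1.r x p.1.2 := fun i p =>
    LatticeCon.exists_of_sup_rel hK (LatticeCon.gen_le_iff.1 (hab i) p.1 p.2)
  choose x hxa hxb using hx
  have : Finite P := hP
  -- One interpolant `x i p` per generating pair `p` of `e`. Passing from `x i p` to `x j p` through
  -- either end of `p` gives the two upper bounds on `c i j`.
  let Q (i j : I) : Set (K × K) := Set.range fun p : P => (x i p, x j p)
  have hQ : ∀ i j p, (LatticeCon.gen (Q i j)).r (x i p) (x j p) := fun i j p =>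
    LatticeCon.gen_rel ⟨p, rfl⟩
  have hle : ∀ {c d : LatticeCon K}, c ≤ c ⊔ d ∧ d ≤ c ⊔ d := ⟨le_sup_left, le_sup_right⟩
  refine ⟨fun i j => ⟨LatticeCon.gen (Q i j),
    LatticeCon.isCompactElement_gen (Set.finite_range _)⟩, fun i j => ?_, fun i j => ?_,
    fun i j => ?_, fun i j k => ?_⟩
  · refine LatticeCon.gen_le_iff.2 ?_
    rintro _ ⟨p, rfl⟩
    exact ((a i).1 ⊔ (a j).1).iseqv.trans (hle.1 ((a i).1.iseqv.symm (hxa i p)))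
      (hle.2 (hxa j p))
  · refine LatticeCon.gen_le_iff.2 ?_
    rintro _ ⟨p, rfl⟩
    exact ((b i).1 ⊔ (b j).1).iseqv.trans (hle.1 (hxb i p))
      (hle.2 ((b j).1.iseqv.symm (hxb j p)))
  · refine LatticeCon.gen_le_iff.2 fun p hp => ?_
    let d : LatticeCon K := LatticeCon.gen (Q i j) ⊔ (a i).1 ⊔ (b j).1
    change d.r p.1 p.2
    have h₁ : LatticeCon.gen (Q i j) ≤ d := le_sup_left.trans le_sup_left
    have h₂ : (a i).1 ≤ d := le_sup_right.trans le_sup_left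
    have h₃ : (b j).1 ≤ d := le_sup_right
    exact d.iseqv.trans (h₂ (hxa i ⟨p, hp⟩)) (d.iseqv.trans (h₁ (hQ i j _)) (h₃ (hxb j ⟨p, hp⟩)))
  · refine LatticeCon.gen_le_iff.2 ?_
    rintro _ ⟨p, rfl⟩
    exact (LatticeCon.gen (Q i j) ⊔ LatticeCon.gen (Q j k)).iseqv.trans
      (hle.1 (hQ i j p)) (hle.2 (hQ j k p))

/-! ## Lattice terms and free lattices -/

namespace LatticeTerm

theorem map_eval {X : Type u} {L : Type v} {M : Type w} [Lattice L] [Lattice M]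
    (g : LatticeHom L M) (f : X → L) (t : LatticeTerm X) :
    g (t.eval f) = t.eval (fun x => g (f x)) := by
  induction t with
  | var x => rfl
  | inf s t hs ht => simp only [eval, map_inf, hs, ht]
  | sup s t hs ht => simp only [eval, map_sup, hs, ht]

/-- The variables occurring in a term. -/
def vars {X : Type u} : LatticeTerm X → Set X
  | .var x => {x}
  | .inf s t => s.vars ∪ t.vars
  | .sup s t => s.vars ∪ t.vars

theorem finite_vars {X : Type u} (t : LatticeTerm X) : t.vars.Finite := by
  induction t with
  | var x => exact Set.finite_singleton x
  | inf s t hs ht => exact hs.union ht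
  | sup s t hs ht => exact hs.union ht

/-- The sublattice of values of terms under an assignment. -/
def range {X : Type u} {L : Type v} [Lattice L] (f : X → L) : Sublattice L where
  carrier := Set.range fun t : LatticeTerm X => t.eval f
  supClosed' := by
    rintro _ ⟨s, rfl⟩ _ ⟨t, rfl⟩
    exact ⟨.sup s t, rfl⟩
  infClosed' := by
    rintro _ ⟨s, rfl⟩ _ ⟨t, rfl⟩
    exact ⟨.inf s t, rfl⟩

end LatticeTerm

/-! ### Generation of free lattices and change of universe. -/

namespace LatticeVariety

variable {V : LatticeVariety}

theorem Mem.of_injective {L : Type v} {M : Type w} [Lattice L] [Lattice M] (hM : V.Mem M)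
    (g : LatticeHom L M) (hg : Function.Injective g) : V.Mem L := by
  intro e he f
  apply hg
  rw [LatticeTerm.map_eval, LatticeTerm.map_eval]
  exact hM e he _

/-- The canonical embedding of a lattice in a higher universe. -/
def upHom (L : Type v) [Lattice L] : LatticeHom L (ULift.{w} L) where
  toFun := ULift.up
  map_sup' _ _ := rfl
  map_inf' _ _ := rfl

/-- The inverse of the canonical embedding of a lattice in a higher universe. -/
def downHom (L : Type v) [Lattice L] : LatticeHom (ULift.{w} L) L where
  toFun := ULift.down
  map_sup' _ _ := rfl
  map_inf' _ _ := rfl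

/-- Lifting `ι` into the sublattice of term values and then including it in `F` agrees with the
identity on generators. `ULift` moves both targets into the universe of the test lattices. -/
theorem IsFree.exists_term {X : Type u} {F : Type v} [Lattice F] {ι : X → F} (hF : V.IsFree ι)
    (w : F) : ∃ t : LatticeTerm X, t.eval ι = w := by
  let S := LatticeTerm.range ι
  have hS : V.Mem (ULift.{u} S) :=
    hF.mem.of_injective (S.subtype.comp (downHom S))
      (Subtype.val_injective.comp ULift.down_injective)
  obtain ⟨g, hg, -⟩ := hF.existsUnique_lift (ULift.{u} S) hS
    fun x => ULift.up ⟨ι x, .var x, rfl⟩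
  have hU : V.Mem (ULift.{u} F) := hF.mem.of_injective (downHom F) ULift.down_injective
  have h := (hF.existsUnique_lift (ULift.{u} F) hU fun x => ULift.up (ι x)).unique
    (y₁ := (upHom F).comp (S.subtype.comp ((downHom S).comp g))) (y₂ := upHom F)
    (fun x => by
      change ULift.up ((g (ι x)).down : F) = _
      rw [hg])
    (fun x => rfl)
  have hw : ((g w).down : F) = w := congrArg ULift.down (DFunLike.congr_fun h w)
  obtain ⟨t, ht⟩ := (g w).down.2
  exact ⟨t, ht.trans hw⟩

theorem IsFree.comp_equiv {X Y : Type u} {F : Type v} [Lattice F] {ι : X → F} (hF : V.IsFree ι)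
    (e : Y ≃ X) : V.IsFree (ι ∘ e) where
  mem := hF.mem
  existsUnique_lift L _ hL f := by
    obtain ⟨g, hg, hu⟩ := hF.existsUnique_lift L hL (f ∘ e.symm)
    refine ⟨g, fun y => by simp [hg], fun g' hg' => hu g' fun x => ?_⟩
    simpa using hg' (e.symm x)

/-- A nondistributive variety has, in every universe, a member with an element that has two
distinct relative complements. -/
theorem exists_relative_complements (hV : ¬ V.IsDistributive) :
    ∃ (L : Type w) (_ : Lattice L), V.Mem L ∧
      ∃ x y z : L, x ⊓ y = z ⊓ y ∧ x ⊔ y = z ⊔ y ∧ ¬ z ≤ x := by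
  unfold IsDistributive at hV
  push Not at hV
  obtain ⟨M, _, hM, a, b, c, habc⟩ := hV
  have h : ∃ x y z : M, x ⊓ y = z ⊓ y ∧ x ⊔ y = z ⊔ y ∧ ¬ z ≤ x := by
    by_contra! h
    exact habc (inf_sup_eq_of_unique_relative_complements h a b c)
  obtain ⟨x, y, z, hinf, hsup, hzx⟩ := h
  let S := LatticeTerm.range ![x, y, z]
  -- Terms in three variables form a type in the lowest universe, so the sublattice they generate
  -- has a copy in every universe.
  have : Small.{w} S :=
    inferInstanceAs (Small.{w} (Set.range fun t : LatticeTerm (Fin 3) => t.eval ![x, y, z]))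
  let e := equivShrink.{w} S
  let _ : Max (Shrink.{w} S) := ⟨fun a b => e (e.symm a ⊔ e.symm b)⟩
  let _ : Min (Shrink.{w} S) := ⟨fun a b => e (e.symm a ⊓ e.symm b)⟩
  let _ : LE (Shrink.{w} S) := ⟨fun a b => e.symm a ≤ e.symm b⟩
  let _ : LT (Shrink.{w} S) := ⟨fun a b => e.symm a < e.symm b⟩
  let inst : Lattice (Shrink.{w} S) := Function.Injective.lattice e.symm e.symm.injective
    Iff.rfl Iff.rfl (fun _ _ => e.symm_apply_apply _) (fun _ _ => e.symm_apply_apply _)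
  let g : LatticeHom (Shrink.{w} S) S :=
    { toFun := e.symm
      map_sup' := fun _ _ => e.symm_apply_apply _
      map_inf' := fun _ _ => e.symm_apply_apply _ }
  have hx : x ∈ S := ⟨.var 0, rfl⟩
  have hy : y ∈ S := ⟨.var 1, rfl⟩
  have hz : z ∈ S := ⟨.var 2, rfl⟩
  refine ⟨Shrink.{w} S, inst, hM.of_injective (S.subtype.comp g)
    (Subtype.val_injective.comp e.symm.injective), e ⟨x, hx⟩, e ⟨y, hy⟩, e ⟨z, hz⟩, ?_, ?_, ?_⟩
  · exact congrArg e (by simpa [Subtype.ext_iff] using hinf)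
  · exact congrArg e (by simpa [Subtype.ext_iff] using hsup)
  · change ¬ e.symm (e ⟨z, hz⟩) ≤ e.symm (e ⟨x, hx⟩)
    simpa using hzx

end LatticeVariety

/-! ## Failure of weak uniform refinement in free lattices -/

/-- `{lo, x, y, hi}` is a copy of the square of `{lo, hi}`, with `ψ₁` and `ψ₂` the coordinates of
`φ`. -/
theorem LatticeTerm.eval_complements {G : Type u} {L : Type v} [Lattice L] {x y lo hi : L}
    (hinf : x ⊓ y = lo) (hsup : x ⊔ y = hi) {φ ψ₁ ψ₂ : G → L} {t : LatticeTerm G}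
    (h : ∀ g ∈ t.vars, (ψ₁ g = lo ∧ ψ₂ g = lo ∧ φ g = lo) ∨ (ψ₁ g = hi ∧ ψ₂ g = lo ∧ φ g = x) ∨
      (ψ₁ g = lo ∧ ψ₂ g = hi ∧ φ g = y) ∨ (ψ₁ g = hi ∧ ψ₂ g = hi ∧ φ g = hi)) :
    (t.eval ψ₁ = lo ∧ t.eval ψ₂ = lo ∧ t.eval φ = lo) ∨
      (t.eval ψ₁ = hi ∧ t.eval ψ₂ = lo ∧ t.eval φ = x) ∨
      (t.eval ψ₁ = lo ∧ t.eval ψ₂ = hi ∧ t.eval φ = y) ∨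
      (t.eval ψ₁ = hi ∧ t.eval ψ₂ = hi ∧ t.eval φ = hi) := by
  have hlx : lo ≤ x := hinf ▸ inf_le_left
  have hly : lo ≤ y := hinf ▸ inf_le_right
  have hxh : x ≤ hi := hsup ▸ le_sup_left
  have hyh : y ≤ hi := hsup ▸ le_sup_right
  have hlh := hlx.trans hxh
  have hinf' : y ⊓ x = lo := inf_comm x y ▸ hinf
  have hsup' : y ⊔ x = hi := sup_comm x y ▸ hsup
  induction t with
  | var g => exact h g rfl
  | inf s t hs ht =>
    obtain ⟨h₁, h₂, h₃⟩ | ⟨h₁, h₂, h₃⟩ | ⟨h₁, h₂, h₃⟩ | ⟨h₁, h₂, h₃⟩ :=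
      hs fun g hg => h g (Or.inl hg) <;>
    obtain ⟨k₁, k₂, k₃⟩ | ⟨k₁, k₂, k₃⟩ | ⟨k₁, k₂, k₃⟩ | ⟨k₁, k₂, k₃⟩ :=
      ht fun g hg => h g (Or.inr hg) <;>
    simp [eval, h₁, h₂, h₃, k₁, k₂, k₃, hlx, hly, hxh, hyh, hlh, hinf, hinf']
  | sup s t hs ht =>
    obtain ⟨h₁, h₂, h₃⟩ | ⟨h₁, h₂, h₃⟩ | ⟨h₁, h₂, h₃⟩ | ⟨h₁, h₂, h₃⟩ :=
      hs fun g hg => h g (Or.inl hg) <;>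
    obtain ⟨k₁, k₂, k₃⟩ | ⟨k₁, k₂, k₃⟩ | ⟨k₁, k₂, k₃⟩ | ⟨k₁, k₂, k₃⟩ :=
      ht fun g hg => h g (Or.inr hg) <;>
    simp [eval, h₁, h₂, h₃, k₁, k₂, k₃, hlx, hly, hxh, hyh, hlh, hsup, hsup']

/-- Below `x` is an ideal and above `z` a filter, so the dichotomy passes from variables to terms,
`ψ` recording the side. -/
theorem LatticeTerm.eval_separates {G : Type u} {L : Type v} [Lattice L] {x z lo hi : L}
    (hlh : lo ≤ hi) {φ ψ : G → L} {t : LatticeTerm G}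
    (h : ∀ g ∈ t.vars, (ψ g = lo ∧ φ g ≤ x) ∨ (ψ g = hi ∧ z ≤ φ g)) :
    (t.eval ψ = lo ∧ t.eval φ ≤ x) ∨ (t.eval ψ = hi ∧ z ≤ t.eval φ) := by
  induction t with
  | var g => exact h g rfl
  | inf s t hs ht =>
    obtain ⟨h₁, h₂⟩ | ⟨h₁, h₂⟩ := hs fun g hg => h g (Or.inl hg) <;>
    obtain ⟨k₁, k₂⟩ | ⟨k₁, k₂⟩ := ht fun g hg => h g (Or.inr hg) <;>
    simp [eval, h₁, h₂, k₁, k₂, hlh, inf_le_of_left_le, inf_le_of_right_le]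
  | sup s t hs ht =>
    obtain ⟨h₁, h₂⟩ | ⟨h₁, h₂⟩ := hs fun g hg => h g (Or.inl hg) <;>
    obtain ⟨k₁, k₂⟩ | ⟨k₁, k₂⟩ := ht fun g hg => h g (Or.inr hg) <;>
    simp [eval, h₁, h₂, k₁, k₂, hlh, le_sup_of_le_left, le_sup_of_le_right]

/-- Index type for two bounds and a family of pairs. -/
abbrev PairIndex (I : Type u) : Type u := Bool ⊕ I × Bool

/-- The family consisting of the bounds `lo`, `hi` and the pairs `(s i, t i)`. -/
def pairFamily {I : Type u} {L : Type v} (lo hi : L) (s t : I → L) : PairIndex I → L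
  | .inl false => lo
  | .inl true => hi
  | .inr (i, false) => s i
  | .inr (i, true) => t i

/-! ### Congruences of a free lattice generated by two bounds and a family of pairs. -/

section Pairs

variable {I : Type u} {F : Type v} [Lattice F] (ι : PairIndex I → F)

/-- The congruence identifying the two bounds. -/
def boundCon : CompactCon F :=
  ⟨LatticeCon.gen {(ι (.inl false), ι (.inl true))},
    LatticeCon.isCompactElement_gen (Set.toFinite _)⟩

/-- The congruence identifying each member of the `i`-th pair with the corresponding bound. -/
def outerCon (i : I) : CompactCon F :=
  ⟨LatticeCon.gen {(ι (.inl false), ι (.inr (i, false))), (ι (.inr (i, true)), ι (.inl true))},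
    LatticeCon.isCompactElement_gen (Set.toFinite _)⟩

/-- The congruence identifying the members of the `i`-th pair. -/
def innerCon (i : I) : CompactCon F :=
  ⟨LatticeCon.gen {(ι (.inr (i, false)), ι (.inr (i, true)))},
    LatticeCon.isCompactElement_gen (Set.toFinite _)⟩

variable {ι}

theorem boundCon_le_iff {d : LatticeCon F} :
    (boundCon ι).1 ≤ d ↔ d.r (ι (.inl false)) (ι (.inl true)) := by
  simp [boundCon, LatticeCon.gen_le_iff]

theorem outerCon_le_iff {i : I} {d : LatticeCon F} :
    (outerCon ι i).1 ≤ d ↔ d.r (ι (.inl false)) (ι (.inr (i, false))) ∧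
      d.r (ι (.inr (i, true))) (ι (.inl true)) := by
  simp [outerCon, LatticeCon.gen_le_iff]

theorem innerCon_le_iff {i : I} {d : LatticeCon F} :
    (innerCon ι i).1 ≤ d ↔ d.r (ι (.inr (i, false))) (ι (.inr (i, true))) := by
  simp [innerCon, LatticeCon.gen_le_iff]

theorem boundCon_le_sup (i : I) : boundCon ι ≤ outerCon ι i ⊔ innerCon ι i := by
  let d : LatticeCon F := (outerCon ι i).1 ⊔ (innerCon ι i).1
  have h₁ := outerCon_le_iff.1 (le_sup_left : (outerCon ι i).1 ≤ d)
  have h₂ := innerCon_le_iff.1 (le_sup_right : (innerCon ι i).1 ≤ d)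
  exact boundCon_le_iff.2 (d.iseqv.trans h₁.1 (d.iseqv.trans h₂ h₁.2))

/-- The indices of the pairs that occur in the terms of a set of pairs of terms. -/
def pairSupport (P : Set (LatticeTerm (PairIndex I) × LatticeTerm (PairIndex I))) : Set I :=
  Prod.fst '' (Sum.inr ⁻¹' ⋃ p ∈ P, (p.1.vars ∪ p.2.vars))

theorem finite_pairSupport {P : Set (LatticeTerm (PairIndex I) × LatticeTerm (PairIndex I))}
    (hP : P.Finite) : (pairSupport P).Finite :=
  ((hP.biUnion fun p _ => p.1.finite_vars.union p.2.finite_vars).preimage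
    Sum.inr_injective.injOn).image _

theorem mem_pairSupport {P : Set (LatticeTerm (PairIndex I) × LatticeTerm (PairIndex I))}
    {p : LatticeTerm (PairIndex I) × LatticeTerm (PairIndex I)} (hp : p ∈ P) {i : I} {b : Bool}
    (h : Sum.inr (i, b) ∈ p.1.vars ∪ p.2.vars) : i ∈ pairSupport P :=
  ⟨(i, b), Set.mem_biUnion hp h, rfl⟩

/-- The congruence generated by the values of a set of pairs of terms. -/
def termCon (ι : PairIndex I → F)
    (P : Set (LatticeTerm (PairIndex I) × LatticeTerm (PairIndex I))) : LatticeCon F :=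
  LatticeCon.gen ((fun p => (p.1.eval ι, p.2.eval ι)) '' P)

variable {V : LatticeVariety}

theorem LatticeVariety.IsFree.exists_termCon (hF : V.IsFree ι) (c : CompactCon F) :
    ∃ P, P.Finite ∧ c.1 = termCon ι P := by
  obtain ⟨Q, hQ, hc⟩ := LatticeCon.exists_finite_gen c.2
  choose T hT using hF.exists_term
  refine ⟨(fun q => (T q.1, T q.2)) '' Q, hQ.image _, ?_⟩
  rw [hc, termCon, Set.image_image]
  simp [hT]

theorem termCon_le_ker_iff {L : Type w} [Lattice L] (g : LatticeHom F L)
    {P : Set (LatticeTerm (PairIndex I) × LatticeTerm (PairIndex I))} :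
    termCon ι P ≤ LatticeCon.ker g ↔
      ∀ p ∈ P, p.1.eval (fun x => g (ι x)) = p.2.eval fun x => g (ι x) := by
  rw [termCon, LatticeCon.gen_le_iff, Set.forall_mem_image]
  refine forall₂_congr fun p _ => ?_
  rw [← LatticeTerm.map_eval, ← LatticeTerm.map_eval]
  rfl

/-- Away from the `k`-th pair, `g` takes values in `{lo, x, y, hi}` and has coordinates `g₁`, `g₂`.
The kernel of `g₁` contains both inner congruences, that of `g₂` both outer ones, so `termCon ι P`
lies in both kernels. -/
theorem LatticeVariety.IsFree.termCon_le_ker (hF : V.IsFree ι) {L : Type max u v} [Lattice L]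
    (hL : V.Mem L) {x y lo hi : L} (hinf : x ⊓ y = lo) (hsup : x ⊔ y = hi) (hne : lo ≠ hi)
    {P : Set (LatticeTerm (PairIndex I) × LatticeTerm (PairIndex I))} {i j k : I} (hij : i ≠ j)
    (hk : k ∉ pairSupport P)
    (ho : termCon ι P ≤ (outerCon ι i).1 ⊔ (outerCon ι j).1)
    (hi' : termCon ι P ≤ (innerCon ι i).1 ⊔ (innerCon ι j).1)
    {s t : I → L} (hsi : s i = x) (hti : t i = hi) (hsj : s j = lo) (htj : t j = y)
    (hs : ∀ l, l ≠ i → l ≠ j → l ≠ k → s l = lo) (ht : ∀ l, l ≠ i → l ≠ j → l ≠ k → t l = lo)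
    (g : LatticeHom F L) (hg : ∀ q, g (ι q) = pairFamily lo hi s t q) :
    termCon ι P ≤ LatticeCon.ker g := by
  classical
  obtain ⟨g₁, hg₁, -⟩ := hF.existsUnique_lift L hL
    (pairFamily lo hi (fun l => if l = i then hi else lo) fun l => if l = i then hi else lo)
  obtain ⟨g₂, hg₂, -⟩ := hF.existsUnique_lift L hL
    (pairFamily lo hi (fun _ => lo) fun l => if l = i ∨ l = j then hi else lo)
  have h₁ : termCon ι P ≤ LatticeCon.ker g₁ := hi'.trans <| sup_le
    (innerCon_le_iff.2 (by simp [hg₁, pairFamily, Function.onFun]))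
    (innerCon_le_iff.2 (by simp [hg₁, pairFamily, Function.onFun]))
  have h₂ : termCon ι P ≤ LatticeCon.ker g₂ := ho.trans <| sup_le
    (outerCon_le_iff.2 (by simp [hg₂, pairFamily, Function.onFun]))
    (outerCon_le_iff.2 (by simp [hg₂, pairFamily, Function.onFun]))
  rw [termCon_le_ker_iff] at h₁ h₂ ⊢
  intro p hp
  have key : ∀ q ∈ p.1.vars ∪ p.2.vars,
      (g₁ (ι q) = lo ∧ g₂ (ι q) = lo ∧ g (ι q) = lo) ∨
      (g₁ (ι q) = hi ∧ g₂ (ι q) = lo ∧ g (ι q) = x) ∨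
      (g₁ (ι q) = lo ∧ g₂ (ι q) = hi ∧ g (ι q) = y) ∨
      (g₁ (ι q) = hi ∧ g₂ (ι q) = hi ∧ g (ι q) = hi) := by
    intro q hq
    rw [hg, hg₁, hg₂]
    match q, hq with
    | .inl false, _ => simp [pairFamily]
    | .inl true, _ => simp [pairFamily]
    | .inr (l, b), hq =>
      have hlk : l ≠ k := fun h => hk (h ▸ mem_pairSupport hp hq)
      by_cases hli : l = i
      · subst hli
        cases b <;> simp [pairFamily, hsi, hti]
      by_cases hlj : l = j
      · subst hlj
        cases b <;> simp [pairFamily, hsj, htj, hij.symm]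
      cases b <;> simp [pairFamily, hli, hlj, hs l hli hlj hlk, ht l hli hlj hlk]
  have e₁ := h₁ p hp
  have e₂ := h₂ p hp
  -- Equal coordinates force equal values of `g`; the mixed cases contradict `lo ≠ hi`.
  obtain ⟨a₁, a₂, a₃⟩ | ⟨a₁, a₂, a₃⟩ | ⟨a₁, a₂, a₃⟩ | ⟨a₁, a₂, a₃⟩ :=
    LatticeTerm.eval_complements hinf hsup fun q hq => key q (Or.inl hq) <;>
  obtain ⟨b₁, b₂, b₃⟩ | ⟨b₁, b₂, b₃⟩ | ⟨b₁, b₂, b₃⟩ | ⟨b₁, b₂, b₃⟩ :=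
    LatticeTerm.eval_complements hinf hsup fun q hq => key q (Or.inr hq) <;>
  simp_all

/-- Away from the `j`-th pair, values of `g` lie below `x` or above `z`, never both, and `g₁`
records which. If `g` collapsed `termCon ι P`, so would `g₁`, which also collapses `outerCon ι i`
and `innerCon ι k`; by `hb` it would then identify the bounds. -/
theorem LatticeVariety.IsFree.not_termCon_le_ker (hF : V.IsFree ι) {L : Type max u v} [Lattice L]
    (hL : V.Mem L) {x z lo hi : L} (hlx : lo ≤ x) (hzh : z ≤ hi) (hxh : x ≤ hi) (hne : lo ≠ hi)
    (hzx : ¬ z ≤ x)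
    {P : Set (LatticeTerm (PairIndex I) × LatticeTerm (PairIndex I))} {i j k : I} (hik : i ≠ k)
    (hj : j ∉ pairSupport P)
    (hb : (boundCon ι).1 ≤ termCon ι P ⊔ (outerCon ι i).1 ⊔ (innerCon ι k).1)
    {s t : I → L} (hsi : s i = x) (hti : t i = hi) (hsk : s k = z) (htk : t k = hi)
    (hs : ∀ l, l ≠ i → l ≠ j → l ≠ k → s l = lo) (ht : ∀ l, l ≠ i → l ≠ j → l ≠ k → t l = lo)
    (g : LatticeHom F L) (hg : ∀ q, g (ι q) = pairFamily lo hi s t q) :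
    ¬ termCon ι P ≤ LatticeCon.ker g := by
  classical
  intro hle
  obtain ⟨g₁, hg₁, -⟩ := hF.existsUnique_lift L hL
    (pairFamily lo hi (fun l => if l = k then hi else lo)
      fun l => if l = i ∨ l = k then hi else lo)
  refine hne ?_
  suffices h : termCon ι P ≤ LatticeCon.ker g₁ by
    have hb' := hb.trans (sup_le (sup_le h
      (outerCon_le_iff.2 (by simp [hg₁, pairFamily, Function.onFun, hik])))
      (innerCon_le_iff.2 (by simp [hg₁, pairFamily, Function.onFun])))
    simpa [hg₁, pairFamily, Function.onFun] using boundCon_le_iff.1 hb'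
  rw [termCon_le_ker_iff] at hle ⊢
  intro p hp
  have key : ∀ q ∈ p.1.vars ∪ p.2.vars,
      (g₁ (ι q) = lo ∧ g (ι q) ≤ x) ∨ (g₁ (ι q) = hi ∧ z ≤ g (ι q)) := by
    intro q hq
    rw [hg, hg₁]
    match q, hq with
    | .inl false, _ => simp [pairFamily, hlx]
    | .inl true, _ => simp [pairFamily, hzh]
    | .inr (l, b), hq =>
      have hlj : l ≠ j := fun h => hj (h ▸ mem_pairSupport hp hq)
      by_cases hli : l = i
      · subst hli
        cases b <;> simp [pairFamily, hsi, hti, hik, hzh]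
      by_cases hlk : l = k
      · subst hlk
        cases b <;> simp [pairFamily, hsk, htk, hzh]
      cases b <;> simp [pairFamily, hli, hlk, hs l hli hlj hlk, ht l hli hlj hlk, hlx]
  have e := hle p hp
  obtain ⟨a₁, a₂⟩ | ⟨a₁, a₂⟩ :=
    LatticeTerm.eval_separates (hlx.trans hxh) fun q hq => key q (Or.inl hq) <;>
  obtain ⟨b₁, b₂⟩ | ⟨b₁, b₂⟩ :=
    LatticeTerm.eval_separates (hlx.trans hxh) fun q hq => key q (Or.inr hq)
  · rw [a₁, b₁]
  · exact absurd (b₂.trans (e ▸ a₂)) hzx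
  · exact absurd (a₂.trans (e ▸ b₂)) hzx
  · rw [a₁, b₁]

theorem LatticeVariety.IsFree.not_weakUniformRefinement (hV : ¬ V.IsDistributive)
    (hF : V.IsFree ι) (hI : Cardinal.aleph 2 ≤ Cardinal.mk I) :
    ¬ WeakUniformRefinement (CompactCon F) I := by
  classical
  intro hW
  obtain ⟨c, h₁, h₂, h₃, h₄⟩ := hW (boundCon ι) (outerCon ι) (innerCon ι) boundCon_le_sup
  choose P hPf hP using fun i j => hF.exists_termCon (c i j)
  obtain ⟨i, j, k, hij, hjk, hik, hk, hj, hi⟩ := exists_free_triple hI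
    (fun i j => pairSupport (P i j)) fun i j => finite_pairSupport (hPf i j)
  obtain ⟨L, _, hL, x, y, z, hinf, hsup, hzx⟩ :=
    LatticeVariety.exists_relative_complements.{max u v} hV
  have hne : x ⊓ y ≠ x ⊔ y := fun h => hzx <|
    calc z ≤ z ⊔ y := le_sup_left
      _ = x ⊓ y := by rw [← hsup, h]
      _ ≤ x := inf_le_left
  -- The pairs at `i`, `j`, `k` go to `(x, hi)`, `(lo, y)`, `(z, hi)`, where `lo = x ⊓ y` and `hi =
  -- x ⊔ y`; all others go to `(lo, lo)`.
  let s : I → L := fun l => if l = i then x else if l = k then z else x ⊓ y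
  let t : I → L := fun l => if l = i ∨ l = k then x ⊔ y else if l = j then y else x ⊓ y
  obtain ⟨g, hg, -⟩ := hF.existsUnique_lift L hL (pairFamily (x ⊓ y) (x ⊔ y) s t)
  have hsl : ∀ l, l ≠ i → l ≠ j → l ≠ k → s l = x ⊓ y := fun l h _ h' => by simp [s, h, h']
  have htl : ∀ l, l ≠ i → l ≠ j → l ≠ k → t l = x ⊓ y := fun l h h' h'' => by
    simp [t, h, h', h'']
  have hsi : s i = x := by simp [s]
  have hsj : s j = x ⊓ y := by simp [s, hij.symm, hjk]
  have hsk : s k = z := by simp [s, hik.symm]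
  have hti : t i = x ⊔ y := by simp [t]
  have htj : t j = y := by simp [t, hij.symm, hjk]
  have htk : t k = x ⊔ y := by simp [t]
  have hcij : (c i j).1 ≤ LatticeCon.ker g := by
    rw [hP]
    exact hF.termCon_le_ker hL rfl rfl hne hij hk (hP i j ▸ h₁ i j) (hP i j ▸ h₂ i j)
      hsi hti hsj htj hsl htl g hg
  -- The same argument with `k` in the role of `i` and `z` in that of `x`, as `z` is also a
  -- complement of `y` in `[x ⊓ y, x ⊔ y]`.
  have hcjk : (c j k).1 ≤ LatticeCon.ker g := by
    have ho : (c j k).1 ≤ (outerCon ι k).1 ⊔ (outerCon ι j).1 :=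
      (h₁ j k).trans (sup_comm (outerCon ι j) (outerCon ι k)).le
    have hi' : (c j k).1 ≤ (innerCon ι k).1 ⊔ (innerCon ι j).1 :=
      (h₂ j k).trans (sup_comm (innerCon ι j) (innerCon ι k)).le
    rw [hP] at ho hi' ⊢
    exact hF.termCon_le_ker hL hinf.symm hsup.symm hne hjk.symm hi ho hi'
      hsk htk hsj htj (fun l a b c => hsl l c b a) (fun l a b c => htl l c b a) g hg
  refine hF.not_termCon_le_ker hL inf_le_left (hsup ▸ le_sup_left) le_sup_left hne hzx hik hj
    (hP i k ▸ h₃ i k) hsi hti hsk htk hsl htl g hg ?_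
  rw [← hP]
  have hcik : (c i k).1 ≤ (c i j).1 ⊔ (c j k).1 := h₄ i j k
  exact hcik.trans (sup_le hcij hcjk)

end Pairs

theorem mainTheorem8 (V : LatticeVariety)
    (hV : ¬ LatticeVariety.IsDistributive.{z} V)
    {X : Type u} {F : Type v} [Lattice F] (ι : X → F) (hF : V.IsFree ι)
    (hX : Cardinal.aleph 2 ≤ Cardinal.mk X) :
    ¬ ∃ (K : Type w) (_ : Lattice K),
      HasPermutableCongruences K ∧ Nonempty (CompactCon K ≃o CompactCon F) := by
  rintro ⟨K, _, hK, ⟨f⟩⟩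
  have hX₀ : Cardinal.aleph0 ≤ Cardinal.mk X := (Cardinal.aleph0_le_aleph 2).trans hX
  -- As `X` is infinite, its free generators can be reindexed as two bounds and `|X|` many pairs.
  have hcard : Cardinal.mk (PairIndex X) = Cardinal.mk X := by
    have h2 : (2 : Cardinal.{u}) ≤ Cardinal.mk X := (Cardinal.natCast_lt_aleph0 (n := 2)).le.trans hX₀
    simp only [PairIndex, Cardinal.mk_sum, Cardinal.mk_prod, Cardinal.mk_bool,
      Cardinal.lift_ofNat, Cardinal.lift_uzero]
    rw [Cardinal.mul_eq_left hX₀ h2 two_ne_zero, Cardinal.add_eq_right hX₀ h2]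
  obtain ⟨e⟩ := Cardinal.eq.1 hcard
  exact (hF.comp_equiv e).not_weakUniformRefinement hV hX
    ((hK.weakUniformRefinement X).of_orderIso f)
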